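/- Proposition (complement of a fixed-size extended L-ensemble). Let $L\in\mathbb R^{n\times n}$ and $V\in\mathbb R^{n\times p}$ form a nonnegative pair $(L;V)$: $L$ is symmetric, $V$ has full column rank ($p=0$ is allowed), and $x^\top Lx\ge 0$ for every $x$ with $V^\top x=0$. A random subset $\mathcal X\subseteq\{1,\dots,n\}$ is a fixed-size extended L-ensemble of size $m$ based on $(L;V)$, written $\mathcal X\sim|DPP|_m(L;V)$, if for all $X\subseteq\{1,\dots,n\}$ $$\mathbb P(\mathcal X=X)\;\propto\;(-1)^p\det\begin{pmatrix}L_X & V_{X,:}\\ (V_{X,:})^\top & 0\end{pmatrix}\mathbb I(|X|=m).$$ Let $Q\in\mathbb R^{n\times p}$ be an orthonormal basis of $\operatorname{span}V$ (the column span of $V$), put $\widetilde L=(I-QQ^\top)L(I-QQ^\top)$, and let $\widetilde L^\dagger$ be the Moore-Penrose inverse of $\widetilde L$. Let $Z\in\mathbb R^{n\times r}$ be a matrix whose columns form a basis (not necessarily orthonormal) of the part of the kernel of $\widetilde L$ orthogonal to $\operatorname{span}V$, i.e. of $\ker\widetilde L\cap(\operatorname{span}V)^\perp$. If $\mathcal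 X\sim|DPP|_m(L;V)$, then $(\widetilde L^\dagger;Z)$ is a nonnegative pair and the complement $\mathcal X^c=\{1,\dots,n\}\setminus\mathcal X$ satisfies $\mathcal X^c\sim|DPP|_{n-m}(\widetilde L^\dagger;Z)$. -/

import Mathlib

open MeasureTheory

/-- `B` is a Moore-Penrose inverse of the real matrix `A`: the four Penrose equations. -/
structure IsMoorePenroseInverse {k l : ℕ} (A : Matrix (Fin k) (Fin l) ℝ)
    (B : Matrix (Fin l) (Fin k) ℝ) : Prop where
  mul_mul_left : A * B * A = A
  mul_mul_right : B * A * B = B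
  symm_left : (A * B).transpose = A * B
  symm_right : (B * A).transpose = B * A

theorem IsMoorePenroseInverse.unique {k l : ℕ} {A : Matrix (Fin k) (Fin l) ℝ}
    {B C : Matrix (Fin l) (Fin k) ℝ} (hB : IsMoorePenroseInverse A B)
    (hC : IsMoorePenroseInverse A C) : B = C := by
  have h1 : A * B = A * C := by
    calc A * B = (A * B).transpose := hB.symm_left.symm
      _ = ((A * C) * (A * B)).transpose := by
          rw [← Matrix.mul_assoc, hC.mul_mul_left]
      _ = (A * B) * (A * C) := by rw [Matrix.transpose_mul, hB.symm_left, hC.symm_left]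
      _ = A * C := by rw [← Matrix.mul_assoc, hB.mul_mul_left]
  have h2 : B * A = C * A := by
    calc B * A = (B * A).transpose := hB.symm_right.symm
      _ = ((B * A) * (C * A)).transpose := by
          rw [Matrix.mul_assoc B A, ← Matrix.mul_assoc A C A, hC.mul_mul_left]
      _ = (C * A) * (B * A) := by rw [Matrix.transpose_mul, hB.symm_right, hC.symm_right]
      _ = C * A := by rw [Matrix.mul_assoc C A, ← Matrix.mul_assoc A B A, hB.mul_mul_left]
  calc B = B * A * B := hB.mul_mul_right.symm
    _ = C * A * C := by rw [h2, Matrix.mul_assoc, h1, ← Matrix.mul_assoc]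
    _ = C := hC.mul_mul_right

theorem exists_symm_isMoorePenroseInverse {n : ℕ} {S : Matrix (Fin n) (Fin n) ℝ}
    (hS : S.IsSymm) : ∃ B : Matrix (Fin n) (Fin n) ℝ, B.IsSymm ∧ IsMoorePenroseInverse S B := by
  have hH : S.IsHermitian := by
    rw [Matrix.IsHermitian, Matrix.conjTranspose_eq_transpose_of_trivial]
    exact hS
  obtain ⟨U, d, hU, hSd⟩ : ∃ (U : Matrix (Fin n) (Fin n) ℝ) (d : Fin n → ℝ),
      U.transpose * U = 1 ∧ S = U * Matrix.diagonal d * U.transpose := by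
    refine ⟨(hH.eigenvectorUnitary : Matrix (Fin n) (Fin n) ℝ), hH.eigenvalues, ?_, ?_⟩
    · have h := Unitary.coe_star_mul_self hH.eigenvectorUnitary
      rw [Matrix.star_eq_conjTranspose, Matrix.conjTranspose_eq_transpose_of_trivial] at h
      exact h
    · have h := hH.spectral_theorem
      rw [Unitary.conjStarAlgAut_apply, Matrix.star_eq_conjTranspose,
        Matrix.conjTranspose_eq_transpose_of_trivial] at h
      exact h
  have key : ∀ a b : Fin n → ℝ, (U * Matrix.diagonal a * U.transpose) *
      (U * Matrix.diagonal b * U.transpose) =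
        U * Matrix.diagonal (fun i => a i * b i) * U.transpose := by
    intro a b
    calc _ = U * Matrix.diagonal a * (U.transpose * U) * Matrix.diagonal b * U.transpose := by
          simp only [Matrix.mul_assoc]
      _ = _ := by
          rw [hU, Matrix.mul_one, Matrix.mul_assoc U, Matrix.diagonal_mul_diagonal]
  have symm : ∀ a : Fin n → ℝ, (U * Matrix.diagonal a * U.transpose).transpose =
      U * Matrix.diagonal a * U.transpose := by
    intro a
    simp [Matrix.transpose_mul, Matrix.mul_assoc]
  refine ⟨U * Matrix.diagonal (fun i => (d i)⁻¹) * U.transpose, symm _, ?_, ?_, ?_, ?_⟩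
  · rw [hSd, key, key]; congr 3; funext i; exact mul_inv_mul_cancel (d i)
  · rw [hSd, key, key]; congr 3; funext i
    by_cases h : d i = 0 <;> simp [h]
  · rw [hSd, key, symm]
  · rw [hSd, key, symm]

theorem exists_isMoorePenroseInverse {k l : ℕ} (A : Matrix (Fin k) (Fin l) ℝ) :
    ∃ B, IsMoorePenroseInverse A B := by
  obtain ⟨S, hS, h⟩ := exists_symm_isMoorePenroseInverse (S := A.transpose * A)
    (by simp [Matrix.IsSymm, Matrix.transpose_mul])
  refine ⟨S * A.transpose, ?_, ?_, ?_, ?_⟩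
  · have h0 : A.transpose * A * (S * (A.transpose * A) - 1) = 0 := by
      rw [Matrix.mul_sub, ← Matrix.mul_assoc, h.mul_mul_left, Matrix.mul_one, sub_self]
    rw [← Matrix.conjTranspose_eq_transpose_of_trivial,
      Matrix.conjTranspose_mul_self_mul_eq_zero,
      Matrix.conjTranspose_eq_transpose_of_trivial, Matrix.mul_sub, Matrix.mul_one,
      sub_eq_zero] at h0
    rw [Matrix.mul_assoc, Matrix.mul_assoc]
    exact h0
  · calc S * A.transpose * A * (S * A.transpose)
        = (S * (A.transpose * A) * S) * A.transpose := by simp only [Matrix.mul_assoc]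
      _ = S * A.transpose := by rw [h.mul_mul_right]
  · rw [Matrix.transpose_mul, Matrix.transpose_mul, Matrix.transpose_transpose, hS.eq,
      Matrix.mul_assoc]
  · rw [Matrix.mul_assoc]
    exact h.symm_right

/-- The Moore-Penrose inverse of a real matrix. -/
noncomputable def pinv {k l : ℕ} (A : Matrix (Fin k) (Fin l) ℝ) : Matrix (Fin l) (Fin k) ℝ :=
  Classical.choose (exists_isMoorePenroseInverse A)

theorem pinv_spec {k l : ℕ} (A : Matrix (Fin k) (Fin l) ℝ) : IsMoorePenroseInverse A (pinv A) :=
  Classical.choose_spec (exists_isMoorePenroseInverse A)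

/-- The column span of a matrix. -/
def colSpan {n p : ℕ} (V : Matrix (Fin n) (Fin p) ℝ) : Submodule ℝ (Fin n → ℝ) :=
  Submodule.span ℝ (Set.range V.col)

/-- The orthogonal complement of the column span of `V`: all `x` with `Vᵀ x = 0`. -/
def orthCompl {n p : ℕ} (V : Matrix (Fin n) (Fin p) ℝ) : Submodule ℝ (Fin n → ℝ) :=
  LinearMap.ker V.transpose.mulVecLin

/-- The columns of `Z` form a basis of the subspace `W`. -/
structure IsColBasis {n r : ℕ} (Z : Matrix (Fin n) (Fin r) ℝ)
    (W : Submodule ℝ (Fin n → ℝ)) : Prop where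
  linearIndependent : LinearIndependent ℝ Z.col
  colSpan_eq : colSpan Z = W

/-- The columns of `Q` form an orthonormal basis of the column span of `V`. -/
structure IsOrthonormalColBasis {n p : ℕ} (Q V : Matrix (Fin n) (Fin p) ℝ) : Prop where
  orthonormal : Q.transpose * Q = 1
  colSpan_eq : colSpan Q = colSpan V

/-- Nonnegative pair: `L` is symmetric and conditionally positive semi-definite with respect
to `V`, and `V` has full column rank. -/
structure IsNonnegativePair {n p : ℕ} (L : Matrix (Fin n) (Fin n) ℝ)
    (V : Matrix (Fin n) (Fin p) ℝ) : Prop where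
  symm : L.IsSymm
  condPosSemidef : ∀ x : Fin n → ℝ, V.transpose.mulVec x = 0 → 0 ≤ x ⬝ᵥ L.mulVec x
  fullColumnRank : LinearIndependent ℝ V.col

/-- `(I - Q Qᵀ) L (I - Q Qᵀ)`. -/
def compress {n p : ℕ} (L : Matrix (Fin n) (Fin n) ℝ) (Q : Matrix (Fin n) (Fin p) ℝ) :
    Matrix (Fin n) (Fin n) ℝ :=
  (1 - Q * Q.transpose) * L * (1 - Q * Q.transpose)

/-- `(-1)^p` times the determinant of the saddle-point matrix with blocks
`L_X`, `V_{X,:}`, `(V_{X,:})ᵀ`, `0`. -/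
noncomputable def saddleWeight {n p : ℕ} (L : Matrix (Fin n) (Fin n) ℝ)
    (V : Matrix (Fin n) (Fin p) ℝ) (X : Finset (Fin n)) : ℝ :=
  (-1) ^ p * (Matrix.fromBlocks
    (L.submatrix (fun i : X => (i : Fin n)) (fun i : X => (i : Fin n)))
    (V.submatrix (fun i : X => (i : Fin n)) id)
    (V.submatrix (fun i : X => (i : Fin n)) id).transpose
    (0 : Matrix (Fin p) (Fin p) ℝ)).det

/-- The random subset `𝒳` of the ground set is a fixed-size extended L-ensemble of size `m`
based on the nonnegative pair `(L ; V)`: the probability of `𝒳 = X` is proportional to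
`saddleWeight L V X` for `|X| = m`, and is zero for `|X| ≠ m`. -/
structure IsFixedSizeExtLEnsemble {Ω : Type*} [MeasurableSpace Ω] (P : Measure Ω) {n p : ℕ}
    (𝒳 : Ω → Finset (Fin n)) (m : ℕ) (L : Matrix (Fin n) (Fin n) ℝ)
    (V : Matrix (Fin n) (Fin p) ℝ) : Prop where
  nonnegativePair : IsNonnegativePair L V
  measurable : ∀ X : Finset (Fin n), MeasurableSet {ω | 𝒳 ω = X}
  law : ∃ c : ℝ, 0 < c ∧ ∀ X : Finset (Fin n),
    P.real {ω | 𝒳 ω = X} = c * (if X.card = m then saddleWeight L V X else 0)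

/-! Let `S = compress L Q`. It differs from `L` by terms `F * Vᵀ + V * Gᵀ`, which the border `V`
absorbs, so `L` and `S` give the same weights. Moreover `S` is positive semi-definite and its kernel
is the orthogonal sum of span `V` and span `Z`.

Write `V'`, `Z'` for the dual frames of `V`, `Z`. Bordering `S` by `(V, Z')` gives an invertible
matrix `M` whose inverse is `S†` bordered by `(V', Z)` (`bordered_mul_bordered`). Jacobi's identity
equates the minor of `M` on `X` and the `V`-border with `det M` times the minor of `M⁻¹` on `Xᶜ` and
the `Z`-border. These minors are the saddle determinants of `(S; V)` at `X` and `(S†; Z)` at `Xᶜ`,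
so the two weights differ by the factor `(-1)^(p+r) * det M`, which is independent of `X` and
positive (`det_bordered_pos`). -/

/-! ### Determinants of bordered matrices. -/

open Matrix in
/-- Adding multiples of the border blocks to the corner does not change the determinant. -/
theorem Matrix.det_fromBlocks_add_border {α β : Type*} [Fintype α] [DecidableEq α] [Fintype β]
    [DecidableEq β] (A : Matrix α α ℝ) (B F : Matrix α β ℝ) (C G : Matrix β α ℝ) :
    (fromBlocks (A + F * C + B * G) B C 0).det = (fromBlocks A B C 0).det := by
  have h : fromBlocks (A + F * C + B * G) B C 0 =
      fromBlocks 1 F 0 1 * fromBlocks A B C 0 * fromBlocks 1 0 G 1 := by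
    simp [fromBlocks_multiply]
  rw [h, det_mul, det_mul, det_fromBlocks_zero₂₁, det_fromBlocks_zero₁₂]
  simp

open Matrix in
/-- Jacobi's identity for complementary principal minors of an invertible matrix. -/
theorem Matrix.det_mul_det_submatrix_compl {α β ι : Type*} [Fintype α] [DecidableEq α]
    [Fintype β] [DecidableEq β] [Fintype ι] [DecidableEq ι] {M N : Matrix ι ι ℝ}
    (h : M * N = 1) (e : α ⊕ β ≃ ι) :
    M.det * (N.submatrix (e ∘ Sum.inr) (e ∘ Sum.inr)).det =
      (M.submatrix (e ∘ Sum.inl) (e ∘ Sum.inl)).det := by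
  have hMN : M.submatrix e e * N.submatrix e e = 1 := by
    rw [submatrix_mul_equiv, h, submatrix_one_equiv]
  rw [← det_submatrix_equiv_self e M]
  have hM : M.submatrix e e = fromBlocks (M.submatrix e e).toBlocks₁₁ (M.submatrix e e).toBlocks₁₂
    (M.submatrix e e).toBlocks₂₁ (M.submatrix e e).toBlocks₂₂ := (fromBlocks_toBlocks _).symm
  have hN : N.submatrix e e = fromBlocks (N.submatrix e e).toBlocks₁₁ (N.submatrix e e).toBlocks₁₂
    (N.submatrix e e).toBlocks₂₁ (N.submatrix e e).toBlocks₂₂ := (fromBlocks_toBlocks _).symm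
  have hA : M.submatrix (e ∘ Sum.inl) (e ∘ Sum.inl) = (M.submatrix e e).toBlocks₁₁ := rfl
  have hD : N.submatrix (e ∘ Sum.inr) (e ∘ Sum.inr) = (N.submatrix e e).toBlocks₂₂ := rfl
  rw [hA, hD]
  generalize M.submatrix e e = S at *
  generalize N.submatrix e e = T at *
  have hST := hMN
  rw [hM, hN, fromBlocks_multiply, ← fromBlocks_one, fromBlocks_inj] at hST
  obtain ⟨-, h12, -, h22⟩ := hST
  -- Replacing the first block column of the inverse by that of the identity makes both the factor
  -- and the product block triangular.
  have key : S * fromBlocks 1 T.toBlocks₁₂ 0 T.toBlocks₂₂ =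
      fromBlocks S.toBlocks₁₁ 0 S.toBlocks₂₁ 1 := by
    conv_lhs => rw [hM]
    simp [fromBlocks_multiply, h12, h22]
  have := congrArg det key
  rw [det_mul, det_fromBlocks_zero₂₁, det_fromBlocks_zero₁₂] at this
  simpa using this

open Matrix in
/-- The sign of the determinant of a bordered symmetric matrix whose corner becomes positive
definite after adding the Gram matrix of the border. -/
theorem Matrix.neg_one_pow_mul_det_fromBlocks_pos {α β : Type*} [Fintype α] [DecidableEq α]
    [Fintype β] [DecidableEq β] {A : Matrix α α ℝ} {B : Matrix α β ℝ}
    (hA : (A + B * Bᵀ).PosDef) (hB : Function.Injective B.mulVec) :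
    0 < (-1) ^ Fintype.card β * (fromBlocks A B Bᵀ 0).det := by
  have h := det_fromBlocks_add_border A B B Bᵀ 0
  rw [Matrix.mul_zero, add_zero] at h
  have := hA.isUnit.invertible
  -- The Schur complement is minus a Gram-type matrix, positive definite since `B` is injective; its
  -- sign cancels the power of `-1`.
  rw [← h, det_fromBlocks₁₁, zero_sub, det_neg, mul_left_comm, ← mul_assoc ((-1 : ℝ) ^ _),
    ← mul_pow, neg_one_mul, neg_neg, one_pow, one_mul, invOf_eq_nonsing_inv]
  have hS := hA.inv.conjTranspose_mul_mul_same hB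
  rw [conjTranspose_eq_transpose_of_trivial] at hS
  exact mul_pos hA.det_pos hS.det_pos

/-! ### Column spans, dual frames and pseudoinverses. -/

theorem mem_colSpan_iff {n p : ℕ} (V : Matrix (Fin n) (Fin p) ℝ) (x : Fin n → ℝ) :
    x ∈ colSpan V ↔ ∃ c, V.mulVec c = x := by
  rw [colSpan, ← Matrix.range_mulVecLin]
  rfl

theorem mem_orthCompl_iff {n p : ℕ} (V : Matrix (Fin n) (Fin p) ℝ) (x : Fin n → ℝ) :
    x ∈ orthCompl V ↔ V.transpose.mulVec x = 0 := Iff.rfl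

theorem col_mem_colSpan {n p : ℕ} (V : Matrix (Fin n) (Fin p) ℝ) (j : Fin p) :
    V.col j ∈ colSpan V := Submodule.subset_span ⟨j, rfl⟩

theorem exists_eq_mul_of_colSpan_le {n p q : ℕ} {V : Matrix (Fin n) (Fin p) ℝ}
    {W : Matrix (Fin n) (Fin q) ℝ} (h : colSpan V ≤ colSpan W) : ∃ C : Matrix (Fin q) (Fin p) ℝ, V = W * C := by
  choose c hc using fun j => (mem_colSpan_iff W _).1 (h (col_mem_colSpan V j))
  refine ⟨Matrix.of fun i j => c j i, ?_⟩
  ext i j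
  exact (congrFun (hc j) i).symm

theorem transpose_mul_self_posDef {n p : ℕ} {V : Matrix (Fin n) (Fin p) ℝ}
    (hV : LinearIndependent ℝ V.col) : (V.transpose * V).PosDef := by
  have := Matrix.PosDef.conjTranspose_mul_self V (Matrix.mulVec_injective_iff.2 hV)
  rwa [Matrix.conjTranspose_eq_transpose_of_trivial] at this

/-- The dual frame `V (VᵀV)⁻¹` of the columns of `V`. -/
noncomputable def dualFrame {n p : ℕ} (V : Matrix (Fin n) (Fin p) ℝ) : Matrix (Fin n) (Fin p) ℝ :=
  V * (V.transpose * V)⁻¹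

theorem transpose_mul_dualFrame {n p : ℕ} {V : Matrix (Fin n) (Fin p) ℝ}
    (hV : LinearIndependent ℝ V.col) : V.transpose * dualFrame V = 1 := by
  rw [dualFrame, ← Matrix.mul_assoc]
  exact Matrix.mul_nonsing_inv _ ((Matrix.isUnit_iff_isUnit_det _).1
    (transpose_mul_self_posDef hV).isUnit)

theorem dualFrame_transpose_mul {n p : ℕ} {V : Matrix (Fin n) (Fin p) ℝ}
    (hV : LinearIndependent ℝ V.col) : (dualFrame V).transpose * V = 1 := by
  have := congrArg Matrix.transpose (transpose_mul_dualFrame hV)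
  simpa [Matrix.transpose_mul] using this

theorem mul_dualFrame_transpose {n p : ℕ} (V : Matrix (Fin n) (Fin p) ℝ) :
    V * (dualFrame V).transpose = dualFrame V * V.transpose := by
  simp [dualFrame, Matrix.transpose_mul, Matrix.transpose_nonsing_inv, Matrix.mul_assoc]

theorem pinv_isSymm {n : ℕ} {S : Matrix (Fin n) (Fin n) ℝ} (hS : S.IsSymm) : (pinv S).IsSymm := by
  obtain ⟨B, hB, h⟩ := exists_symm_isMoorePenroseInverse hS
  rwa [(pinv_spec S).unique h]

/-- Since `S† = S† S S†` with `S†` symmetric, the form of `S†` at `x` is that of `S` at `S† x`. -/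
theorem pinv_nonneg {n : ℕ} {S : Matrix (Fin n) (Fin n) ℝ} (hS : S.IsSymm)
    (h : ∀ x : Fin n → ℝ, 0 ≤ x ⬝ᵥ S.mulVec x) (x : Fin n → ℝ) :
    0 ≤ x ⬝ᵥ (pinv S).mulVec x := by
  have := h ((pinv S).mulVec x)
  rwa [← (pinv_isSymm hS).eq, Matrix.mulVec_transpose, ← Matrix.dotProduct_mulVec,
    ← Matrix.mulVec_transpose, (pinv_isSymm hS).eq, Matrix.mulVec_mulVec, Matrix.mulVec_mulVec,
    (pinv_spec S).mul_mul_right] at this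

theorem mul_pinv_eq_zero {n p : ℕ} {S : Matrix (Fin n) (Fin n) ℝ} (hS : S.IsSymm)
    {V : Matrix (Fin n) (Fin p) ℝ} (hV : S * V = 0) : V.transpose * pinv S = 0 := by
  have h : V.transpose * S = 0 := by
    have := congrArg Matrix.transpose hV
    simpa [Matrix.transpose_mul, hS.eq] using this
  have hs : pinv S * S = S * pinv S := by
    rw [← (pinv_spec S).symm_right, Matrix.transpose_mul, hS.eq, (pinv_isSymm hS).eq]
  rw [← (pinv_spec S).mul_mul_right, hs, ← Matrix.mul_assoc, ← Matrix.mul_assoc, h]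
  simp

/-! ### The bordered matrix, its inverse and its sign. -/

/-- A symmetric positive semi-definite matrix together with bases `V` and `Z` of two orthogonal
parts of its kernel that exhaust it. -/
structure IsKernelSplitting {n p r : ℕ} (S : Matrix (Fin n) (Fin n) ℝ)
    (V : Matrix (Fin n) (Fin p) ℝ) (Z : Matrix (Fin n) (Fin r) ℝ) : Prop where
  symm : S.IsSymm
  nonneg : ∀ x : Fin n → ℝ, 0 ≤ x ⬝ᵥ S.mulVec x
  mul_left : S * V = 0
  fullColumnRank : LinearIndependent ℝ V.col
  isColBasis : IsColBasis Z (orthCompl S ⊓ orthCompl V)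

namespace IsKernelSplitting

variable {n p r : ℕ} {S : Matrix (Fin n) (Fin n) ℝ} {V : Matrix (Fin n) (Fin p) ℝ}
  {Z : Matrix (Fin n) (Fin r) ℝ}

theorem col_mem (h : IsKernelSplitting S V Z) (j : Fin r) :
    Z.col j ∈ orthCompl S ⊓ orthCompl V := by
  rw [← h.isColBasis.colSpan_eq]
  exact col_mem_colSpan Z j

theorem mul_right (h : IsKernelSplitting S V Z) : S * Z = 0 := by
  ext i j
  have := (h.col_mem j).1
  rw [SetLike.mem_coe, mem_orthCompl_iff, h.symm.eq] at this
  exact congrFun this i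

theorem transpose_mul (h : IsKernelSplitting S V Z) : V.transpose * Z = 0 := by
  ext i j
  exact congrFun ((mem_orthCompl_iff _ _).1 (h.col_mem j).2) i

theorem transpose_mul' (h : IsKernelSplitting S V Z) : Z.transpose * V = 0 := by
  have := congrArg Matrix.transpose h.transpose_mul
  simpa [Matrix.transpose_mul] using this

/-- The first two conditions put `x` in span `Z`, and the third makes it orthogonal to that span. -/
theorem eq_zero_of_mulVec (h : IsKernelSplitting S V Z) {x : Fin n → ℝ} (hS : S.mulVec x = 0)
    (hV : V.transpose.mulVec x = 0) (hZ : Z.transpose.mulVec x = 0) : x = 0 := by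
  have hx : x ∈ orthCompl S ⊓ orthCompl V := by
    refine ⟨?_, hV⟩
    rwa [SetLike.mem_coe, mem_orthCompl_iff, h.symm.eq]
  rw [← h.isColBasis.colSpan_eq, mem_colSpan_iff] at hx
  obtain ⟨c, rfl⟩ := hx
  have hc : c = 0 := by
    have h1 := congrArg ((dualFrame Z).transpose * dualFrame Z).mulVec hZ
    rw [Matrix.mulVec_mulVec, Matrix.mul_assoc, ← mul_dualFrame_transpose, Matrix.mulVec_mulVec,
      Matrix.mul_assoc, Matrix.mul_assoc, dualFrame_transpose_mul h.isColBasis.linearIndependent,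
      Matrix.mul_one, dualFrame_transpose_mul h.isColBasis.linearIndependent] at h1
    simpa using h1
  simp [hc]

/-- The summands are the orthogonal projections onto the range of `S`, span `V` and span `Z`. Each
column of the difference from `1` is killed by `S`, `Vᵀ` and `Zᵀ`, hence vanishes. -/
theorem mul_pinv_add (h : IsKernelSplitting S V Z) :
    S * pinv S + V * (dualFrame V).transpose + dualFrame Z * Z.transpose = 1 := by
  have hV := transpose_mul_dualFrame h.fullColumnRank
  have hZ := transpose_mul_dualFrame h.isColBasis.linearIndependent
  have hVd : V.transpose * dualFrame Z = 0 := by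
    rw [dualFrame, ← Matrix.mul_assoc, h.transpose_mul, Matrix.zero_mul]
  have hZd : Z.transpose * dualFrame V = 0 := by
    rw [dualFrame, ← Matrix.mul_assoc, h.transpose_mul', Matrix.zero_mul]
  have hSZ : S * dualFrame Z = 0 := by
    rw [dualFrame, ← Matrix.mul_assoc, h.mul_right, Matrix.zero_mul]
  have hSV' : S * dualFrame V = 0 := by
    rw [dualFrame, ← Matrix.mul_assoc, h.mul_left, Matrix.zero_mul]
  have hSV : V.transpose * S = 0 := by
    have := congrArg Matrix.transpose h.mul_left
    simpa [Matrix.transpose_mul, h.symm.eq] using this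
  have hSZ' : Z.transpose * S = 0 := by
    have := congrArg Matrix.transpose h.mul_right
    simpa [Matrix.transpose_mul, h.symm.eq] using this
  have hs : S * (S * pinv S) = S := by
    have : S * pinv S = pinv S * S := by
      rw [← (pinv_spec S).symm_left, Matrix.transpose_mul, h.symm.eq, (pinv_isSymm h.symm).eq]
    rw [this, ← Matrix.mul_assoc, (pinv_spec S).mul_mul_left]
  rw [mul_dualFrame_transpose]
  refine Matrix.ext_of_mulVec_single fun i => ?_
  rw [← sub_eq_zero, ← Matrix.sub_mulVec]
  refine h.eq_zero_of_mulVec ?_ ?_ ?_ <;> rw [Matrix.mulVec_mulVec]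
  · simp [Matrix.mul_sub, Matrix.mul_add, hs, ← Matrix.mul_assoc S (dualFrame _), hSZ, hSV']
    rfl
  · simp [Matrix.mul_sub, Matrix.mul_add, ← Matrix.mul_assoc, hSV, hV, hVd]
    rfl
  · simp [Matrix.mul_sub, Matrix.mul_add, ← Matrix.mul_assoc, hSZ', hZ, hZd]
    rfl

/-- Dualising opposite halves of the two borders makes them biorthogonal, while leaving `V` itself
in one matrix and `Z` itself in the other, as the two saddle matrices require. -/
theorem bordered_mul_bordered (h : IsKernelSplitting S V Z) :
    Matrix.fromBlocks S (Matrix.fromCols V (dualFrame Z))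
        (Matrix.fromCols V (dualFrame Z)).transpose 0 *
      Matrix.fromBlocks (pinv S) (Matrix.fromCols (dualFrame V) Z)
        (Matrix.fromCols (dualFrame V) Z).transpose 0 = 1 := by
  have hSV : S * dualFrame V = 0 := by
    rw [dualFrame, ← Matrix.mul_assoc, h.mul_left, Matrix.zero_mul]
  have hSZ : S * dualFrame Z = 0 := by
    rw [dualFrame, ← Matrix.mul_assoc, h.mul_right, Matrix.zero_mul]
  have hZV : (dualFrame Z).transpose * dualFrame V = 0 := by
    simp [dualFrame, Matrix.transpose_mul, Matrix.mul_assoc, ← Matrix.mul_assoc Z.transpose V,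
      h.transpose_mul']
  rw [Matrix.fromBlocks_multiply, ← Matrix.fromBlocks_one]
  congr 1
  · rw [Matrix.transpose_fromCols, Matrix.fromCols_mul_fromRows, ← add_assoc, h.mul_pinv_add]
  · simp [Matrix.mul_fromCols, hSV, h.mul_right]
  · simp [Matrix.transpose_fromCols, Matrix.fromRows_mul, mul_pinv_eq_zero h.symm h.mul_left,
      mul_pinv_eq_zero h.symm hSZ]
  · rw [Matrix.mul_zero, add_zero, Matrix.transpose_fromCols, Matrix.fromRows_mul_fromCols,
      transpose_mul_dualFrame h.fullColumnRank, h.transpose_mul, hZV,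
      dualFrame_transpose_mul h.isColBasis.linearIndependent, Matrix.fromBlocks_one]

theorem det_bordered_pos (h : IsKernelSplitting S V Z) :
    0 < (-1) ^ (p + r) * (Matrix.fromBlocks S (Matrix.fromCols V (dualFrame Z))
        (Matrix.fromCols V (dualFrame Z)).transpose 0).det := by
  have hB : (Matrix.fromCols (dualFrame V) Z).transpose * Matrix.fromCols V (dualFrame Z) = 1 := by
    have := h.bordered_mul_bordered
    -- Read off the lower-right block of the product in the reverse order.
    rw [mul_eq_one_comm, Matrix.fromBlocks_multiply, ← Matrix.fromBlocks_one,
      Matrix.fromBlocks_inj] at this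
    simpa using this.2.2.2
  have hpsd : S.PosSemidef := by
    refine Matrix.PosSemidef.of_dotProduct_mulVec_nonneg ?_ fun x => by simpa using h.nonneg x
    rw [Matrix.IsHermitian, Matrix.conjTranspose_eq_transpose_of_trivial, h.symm.eq]
  have hgram : (Matrix.fromCols V (dualFrame Z) *
      (Matrix.fromCols V (dualFrame Z)).transpose).PosSemidef := by
    have := Matrix.posSemidef_self_mul_conjTranspose (Matrix.fromCols V (dualFrame Z))
    rwa [Matrix.conjTranspose_eq_transpose_of_trivial] at this
  have key := Matrix.neg_one_pow_mul_det_fromBlocks_pos (A := S)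
    (B := Matrix.fromCols V (dualFrame Z)) ?_ ?_
  · simpa using key
  · refine Matrix.PosDef.of_dotProduct_mulVec_pos (hpsd.add hgram).isHermitian fun x hx => ?_
    refine lt_of_le_of_ne ((hpsd.add hgram).dotProduct_mulVec_nonneg x) fun h0 => hx ?_
    rw [Matrix.add_mulVec, dotProduct_add] at h0
    have h1 := hpsd.dotProduct_mulVec_nonneg x
    have h2 := hgram.dotProduct_mulVec_nonneg x
    have hS := (hpsd.dotProduct_mulVec_zero_iff x).1 (by linarith)
    have hG := (hgram.dotProduct_mulVec_zero_iff x).1 (by linarith)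
    have hBx : (Matrix.fromCols V (dualFrame Z)).transpose.mulVec x = 0 := by
      have h3 := congrArg (Matrix.fromCols (dualFrame V) Z).transpose.mulVec hG
      rw [Matrix.mulVec_mulVec, ← Matrix.mul_assoc, hB, Matrix.one_mul, Matrix.mulVec_zero] at h3
      exact h3
    rw [Matrix.transpose_fromCols, Matrix.fromRows_mulVec] at hBx
    have hV : V.transpose.mulVec x = 0 := funext fun i => congrFun hBx (Sum.inl i)
    have hZ : (dualFrame Z).transpose.mulVec x = 0 := funext fun i => congrFun hBx (Sum.inr i)
    refine h.eq_zero_of_mulVec hS hV ?_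
    -- Multiplying by `ZᵀZ` turns the dual frame back into `Z`.
    have h4 := congrArg (Z.transpose * Z).mulVec hZ
    rwa [Matrix.mulVec_mulVec, Matrix.mul_assoc, mul_dualFrame_transpose, ← Matrix.mul_assoc,
      transpose_mul_dualFrame h.isColBasis.linearIndependent, Matrix.one_mul,
      Matrix.mulVec_zero] at h4
  · intro x y hxy
    have h3 := congrArg (Matrix.fromCols (dualFrame V) Z).transpose.mulVec hxy
    simpa only [Matrix.mulVec_mulVec, hB, Matrix.one_mulVec] using h3

end IsKernelSplitting

/-! ### Complementary weights and the law of the complement. -/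

/-- The index equivalence which splits the ground set into `X` and its complement. -/
def complSumEquiv {n : ℕ} (X : Finset (Fin n)) (β γ : Type*) :
    (X ⊕ β) ⊕ ((Xᶜ : Finset (Fin n)) ⊕ γ) ≃ Fin n ⊕ (β ⊕ γ) :=
  (Equiv.sumSumSumComm X β (Xᶜ : Finset (Fin n)) γ).trans
    (Equiv.sumCongr ((Equiv.sumCongr (Equiv.refl _) (Equiv.subtypeEquivRight (by simp))).trans
      (Equiv.sumCompl (· ∈ X))) (Equiv.refl _))

theorem IsKernelSplitting.saddleWeight_pinv_compl {n p r : ℕ} {S : Matrix (Fin n) (Fin n) ℝ}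
    {V : Matrix (Fin n) (Fin p) ℝ} {Z : Matrix (Fin n) (Fin r) ℝ} (h : IsKernelSplitting S V Z) :
    ∃ c : ℝ, 0 < c ∧ ∀ X, saddleWeight S V X = c * saddleWeight (pinv S) Z Xᶜ := by
  refine ⟨_, h.det_bordered_pos, fun X => ?_⟩
  have key := Matrix.det_mul_det_submatrix_compl h.bordered_mul_bordered
    (complSumEquiv X (Fin p) (Fin r))
  have e1 : (Matrix.fromBlocks S (Matrix.fromCols V (dualFrame Z))
      (Matrix.fromCols V (dualFrame Z)).transpose 0).submatrix
      (complSumEquiv X (Fin p) (Fin r) ∘ Sum.inl) (complSumEquiv X (Fin p) (Fin r) ∘ Sum.inl) =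
      Matrix.fromBlocks (S.submatrix (fun i : X => (i : Fin n)) (fun i : X => (i : Fin n)))
        (V.submatrix (fun i : X => (i : Fin n)) id)
        (V.submatrix (fun i : X => (i : Fin n)) id).transpose (0 : Matrix (Fin p) (Fin p) ℝ) := by
    ext (i | i) (j | j) <;> rfl
  have e2 : (Matrix.fromBlocks (pinv S) (Matrix.fromCols (dualFrame V) Z)
      (Matrix.fromCols (dualFrame V) Z).transpose 0).submatrix
      (complSumEquiv X (Fin p) (Fin r) ∘ Sum.inr) (complSumEquiv X (Fin p) (Fin r) ∘ Sum.inr) =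
      Matrix.fromBlocks ((pinv S).submatrix (fun i : (Xᶜ : Finset (Fin n)) => (i : Fin n))
          (fun i : (Xᶜ : Finset (Fin n)) => (i : Fin n)))
        (Z.submatrix (fun i : (Xᶜ : Finset (Fin n)) => (i : Fin n)) id)
        (Z.submatrix (fun i : (Xᶜ : Finset (Fin n)) => (i : Fin n)) id).transpose
        (0 : Matrix (Fin r) (Fin r) ℝ) := by
    ext (i | i) (j | j) <;> rfl
  rw [e1, e2] at key
  have hr : ((-1 : ℝ) ^ r) * (-1) ^ r = 1 := by rw [← mul_pow]; simp
  rw [saddleWeight, saddleWeight, ← key, pow_add]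
  linear_combination (-(-1 : ℝ) ^ p *
    (Matrix.fromBlocks S (Matrix.fromCols V (dualFrame Z))
      (Matrix.fromCols V (dualFrame Z)).transpose 0).det *
    (Matrix.fromBlocks ((pinv S).submatrix (fun i : (Xᶜ : Finset (Fin n)) => (i : Fin n))
        (fun i : (Xᶜ : Finset (Fin n)) => (i : Fin n)))
      (Z.submatrix (fun i : (Xᶜ : Finset (Fin n)) => (i : Fin n)) id)
      (Z.submatrix (fun i : (Xᶜ : Finset (Fin n)) => (i : Fin n)) id).transpose
      (0 : Matrix (Fin r) (Fin r) ℝ)).det) * hr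

/-- Restricted to `X`, the added terms are row and column operations using the border blocks. -/
theorem saddleWeight_add_mul_transpose {n p : ℕ} (L : Matrix (Fin n) (Fin n) ℝ)
    (V F G : Matrix (Fin n) (Fin p) ℝ) (X : Finset (Fin n)) :
    saddleWeight (L + F * V.transpose + V * G.transpose) V X = saddleWeight L V X := by
  rw [saddleWeight, saddleWeight]
  congr 1
  exact Matrix.det_fromBlocks_add_border
    (L.submatrix (fun i : X => (i : Fin n)) (fun i : X => (i : Fin n)))
    (V.submatrix (fun i : X => (i : Fin n)) id) (F.submatrix (fun i : X => (i : Fin n)) id)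
    (V.submatrix (fun i : X => (i : Fin n)) id).transpose
    (G.submatrix (fun i : X => (i : Fin n)) id).transpose

theorem IsOrthonormalColBasis.saddleWeight_compress {n p : ℕ} {V Q : Matrix (Fin n) (Fin p) ℝ}
    (hQ : IsOrthonormalColBasis Q V) (L : Matrix (Fin n) (Fin n) ℝ) (X : Finset (Fin n)) :
    saddleWeight (compress L Q) V X = saddleWeight L V X := by
  obtain ⟨C, hC⟩ := exists_eq_mul_of_colSpan_le hQ.colSpan_eq.le
  have hP : Q * Q.transpose = V * (Q * C.transpose).transpose := by
    rw [Matrix.transpose_mul, Matrix.transpose_transpose, ← Matrix.mul_assoc, ← hC]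
  have hP' : Q * Q.transpose = Q * C.transpose * V.transpose := by
    have := congrArg Matrix.transpose hP
    simpa [Matrix.transpose_mul, Matrix.mul_assoc] using this
  -- With `P = QQᵀ`, expand `(1 - P)L(1 - P) = L - (1 - P)LP - PL`; since `Q = VC`, each `P` can be
  -- written with a factor `Vᵀ` on the right or `V` on the left.
  have hE : compress L Q = L + (-((1 - Q * Q.transpose) * L * (Q * C.transpose))) * V.transpose +
      V * (-(L.transpose * (Q * C.transpose))).transpose := by
    have h1 : (-((1 - Q * Q.transpose) * L * (Q * C.transpose))) * V.transpose =
        -((1 - Q * Q.transpose) * L * (Q * Q.transpose)) := by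
      rw [Matrix.neg_mul, Matrix.mul_assoc _ (Q * C.transpose), ← hP']
    have h2 : V * (-(L.transpose * (Q * C.transpose))).transpose = -(Q * Q.transpose * L) := by
      rw [Matrix.transpose_neg, Matrix.transpose_mul, Matrix.transpose_transpose, Matrix.mul_neg,
        ← Matrix.mul_assoc, ← hP]
    rw [h1, h2, compress]
    noncomm_ring
  rw [hE, saddleWeight_add_mul_transpose]

/-- `1 - QQᵀ` kills `V` and maps into its orthogonal complement, where the form of `L` is
nonnegative. -/
theorem IsNonnegativePair.isKernelSplitting_compress {n p r : ℕ} {L : Matrix (Fin n) (Fin n) ℝ}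
    {V Q : Matrix (Fin n) (Fin p) ℝ} {Z : Matrix (Fin n) (Fin r) ℝ} (h : IsNonnegativePair L V)
    (hQ : IsOrthonormalColBasis Q V)
    (hZ : IsColBasis Z (orthCompl (compress L Q) ⊓ orthCompl V)) :
    IsKernelSplitting (compress L Q) V Z := by
  obtain ⟨C, hC⟩ := exists_eq_mul_of_colSpan_le hQ.colSpan_eq.ge
  have hsymm : (1 - Q * Q.transpose).transpose = 1 - Q * Q.transpose := by
    simp [Matrix.transpose_mul]
  have hV : (1 - Q * Q.transpose) * V = 0 := by
    rw [hC, Matrix.sub_mul, Matrix.one_mul, Matrix.mul_assoc Q, ← Matrix.mul_assoc Q.transpose,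
      hQ.orthonormal, Matrix.one_mul, sub_self]
  have hV' : V.transpose * (1 - Q * Q.transpose) = 0 := by
    have := congrArg Matrix.transpose hV
    rwa [Matrix.transpose_mul, hsymm, Matrix.transpose_zero] at this
  refine ⟨?_, fun x => ?_, ?_, h.fullColumnRank, hZ⟩
  · rw [Matrix.IsSymm, compress, Matrix.transpose_mul, Matrix.transpose_mul, hsymm, h.symm.eq,
      Matrix.mul_assoc]
  · have := h.condPosSemidef ((1 - Q * Q.transpose).mulVec x) (by
      rw [Matrix.mulVec_mulVec, hV', Matrix.zero_mulVec])
    rwa [dotProduct_comm, Matrix.dotProduct_mulVec, ← Matrix.mulVec_transpose, hsymm,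
      dotProduct_comm, Matrix.mulVec_mulVec, Matrix.mulVec_mulVec] at this
  · rw [compress, Matrix.mul_assoc, hV, Matrix.mul_zero]

theorem IsKernelSplitting.isNonnegativePair_pinv {n p r : ℕ} {S : Matrix (Fin n) (Fin n) ℝ}
    {V : Matrix (Fin n) (Fin p) ℝ} {Z : Matrix (Fin n) (Fin r) ℝ} (h : IsKernelSplitting S V Z) :
    IsNonnegativePair (pinv S) Z :=
  ⟨pinv_isSymm h.symm, fun x _ => pinv_nonneg h.symm h.nonneg x, h.isColBasis.linearIndependent⟩

/-- If `m > n`, every value of `𝒳` has probability zero, contradicting total mass one. This makes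
the natural-number subtraction `n - m` a true difference. -/
theorem IsFixedSizeExtLEnsemble.size_le {Ω : Type*} [MeasurableSpace Ω] {P : Measure Ω}
    [IsProbabilityMeasure P] {n p m : ℕ} {L : Matrix (Fin n) (Fin n) ℝ}
    {V : Matrix (Fin n) (Fin p) ℝ} {𝒳 : Ω → Finset (Fin n)}
    (h : IsFixedSizeExtLEnsemble P 𝒳 m L V) : m ≤ n := by
  by_contra hm
  obtain ⟨c, -, hc⟩ := h.law
  have h0 : ∀ X, P {ω | 𝒳 ω = X} = 0 := fun X => by
    have hX : X.card ≠ m := by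
      have := X.card_le_univ
      rw [Fintype.card_fin] at this
      omega
    rw [← measureReal_eq_zero_iff, hc, if_neg hX, mul_zero]
  have hU : P (⋃ X, {ω | 𝒳 ω = X}) = 0 := measure_iUnion_null h0
  rw [show (⋃ X, {ω | 𝒳 ω = X}) = Set.univ by ext; simp, measure_univ] at hU
  exact one_ne_zero hU

theorem mainTheorem8 {Ω : Type*} [MeasurableSpace Ω] (P : Measure Ω) [IsProbabilityMeasure P]
    (n p r m : ℕ) (L : Matrix (Fin n) (Fin n) ℝ) (V Q : Matrix (Fin n) (Fin p) ℝ)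
    (Z : Matrix (Fin n) (Fin r) ℝ) (𝒳 : Ω → Finset (Fin n))
    (h𝒳 : IsFixedSizeExtLEnsemble P 𝒳 m L V)
    (hQ : IsOrthonormalColBasis Q V)
    (hZ : IsColBasis Z (orthCompl (compress L Q) ⊓ orthCompl V)) :
    IsFixedSizeExtLEnsemble P (fun ω => (𝒳 ω)ᶜ) (n - m) (pinv (compress L Q)) Z := by

  have hS := h𝒳.nonnegativePair.isKernelSplitting_compress hQ hZ
  have hmn := h𝒳.size_le
  have hset : ∀ X : Finset (Fin n), {ω | (𝒳 ω)ᶜ = X} = {ω | 𝒳 ω = Xᶜ} := fun X => by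
    ext ω
    exact compl_eq_comm.trans eq_comm
  refine ⟨hS.isNonnegativePair_pinv, fun X => ?_, ?_⟩
  · rw [hset]
    exact h𝒳.measurable _
  · obtain ⟨c, hc, hlaw⟩ := h𝒳.law
    obtain ⟨d, hd, hw⟩ := hS.saddleWeight_pinv_compl
    refine ⟨c * d, mul_pos hc hd, fun X => ?_⟩
    have hX : X.card ≤ n := X.card_le_univ.trans (Fintype.card_fin n).le
    have hiff : Xᶜ.card = m ↔ X.card = n - m := by
      rw [Finset.card_compl, Fintype.card_fin]
      omega
    rw [hset, hlaw, ← hQ.saddleWeight_compress, hw, compl_compl]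
    simp only [hiff]
    split_ifs <;> ring
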